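/- Let $p$ be prime, $\omega=e^{2\pi i/p}$, and let a qupit be a $p$-level system with basis $|r\rangle$, $r\in\mathbb F_p$. Let $H|s\rangle=p^{-1/2}\sum_r\omega^{rs}|r\rangle$, $Z^{\mathbf c}|x\rangle=\omega^{\mathbf c\cdot x}|x\rangle$ and $C_z|r\rangle|s\rangle=\omega^{rs}|r\rangle|s\rangle$. Graphs have no loops, and their edges are labelled by nonzero elements of $\mathbb F_p$. The graph state $|\psi\rangle_{\mathcal G}$ of a graph $\mathcal G$ with adjacency matrix $(g_{ij})$ is obtained from $|0\cdots0\rangle$ by applying $H^\dagger$ to every qupit and then $C_z^{g_{ij}}$ once for every pair $\{i,j\}$ of vertices. A CWS code $\mathcal Q=(\mathcal G,\mathcal C)$, with $\mathcal C$ a set of vectors in $\mathbb F_p^{V(\mathcal G)}$, is the span of the states $Z^{\mathbf c}|\psi\rangle_{\mathcal G}$, $\mathbf c\in\mathcal C$. It is a graph code encoding $k$ qupits if $\mathcal C$ is linear with a basis $\alpha_1,\dots,\alpha_k$. It is then represented by the graph $\mathcal G^{\mathcal C}$, obtained from $\mathcal G$ by adding input vertices $1,\dots,k$ and joining input vertex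 $i$ to vertex $j$ by an edge labelled $\alpha_{ij}$ (no edge if $\alpha_{ij}=0$). Its encoder is the circuit that adjoins $|\psi\rangle_{\mathcal G}$ to the $k$ input qupits, applies $H^\dagger$ to each input qupit, applies $C_z^{\alpha_{ij}}$ to input qupit $i$ and qupit $j$ of $|\psi\rangle_{\mathcal G}$ for all $i,j$, applies $H$ to each input qupit, and measures the input qupits in the computational basis with outcome $0$ (the result being normalized). Let $\mathcal Q_{\rm in}=(\mathcal G_{\rm in},\mathcal C_{\rm in})$ be a graph code encoding $k$ qupits into $n$ qupits, with basis $\alpha_1,\dots,\alpha_k$ of $\mathcal C_{\rm in}$, and let $\mathcal Q_{\rm out}=(\mathcal G_{\rm out},\mathcal C_{\rm out})$ be a CWS code on $kn'$ qupits $(i,a)$ with $1\le i\le n'$, $1\le a\le k$. If $(i,a)$ and $(i,b)$, $a\neq b$, are adjacent in $\mathcal G_{\rm out}$, assume that $\alpha_a$ and $\alpha_b$ have disjoint supports (this is automatic when $k=1$, and when $\mathcal G_{\rm out}$ has no edge inside a block $\{(i,a):1\le a\le k\}$, as for a graph on $n'$ vertices describing $p^k$-level systems). The concatenated code $\mathcal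 Q_c$ is the image of $\mathcal Q_{\rm out}$ under the encoder of $\mathcal Q_{\rm in}$ applied separately to each of the $n'$ blocks. The concatenated classical code $\mathcal C_c$ consists of the words $\bigl(\sum_a c_{(i,a)}\alpha_a\bigr)_{1\le i\le n'}$, $c\in\mathcal C_{\rm out}$. The encoding graph of $\mathcal Q_c$ has the auxiliary vertices $(i,a)$, which carry $\mathcal G_{\rm out}$; for each $i$ a copy of $\mathcal G_{\rm in}$ on $n$ output vertices; an edge labelled $\alpha_{aj}$ between $(i,a)$ and output vertex $j$ of the $i$-th copy whenever $\alpha_{aj}\ne0$; and, in the version for linear $\mathcal C_{\rm out}$, also the input vertices of $\mathcal G_{\rm out}^{\mathcal C_{\rm out}}$ with their edges to the auxiliary vertices. Procedure 1 on this graph is: (1) for each auxiliary vertex $u$ let $S_u$ be the set of output vertices adjacent to $u$ and $\mathbf v_u$ the vector of labels of the edges from $u$ to $S_u$ (zero on all the other vertices); (2) delete all edges between auxiliary and output vertices; (3) for each auxiliary vertex $u$ in turn, in any order, perform the generalized local complementation at $(u,\mathbf v_u)$, i.e. replace the current adjacency matrix $F$ by $F+\mathbf v_u^T\mathbf f_u+\mathbf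 f_u^T\mathbf v_u$, where $\mathbf f_u$ is row $u$ of $F$; this is defined only if $\mathbf v_u$ vanishes on $u$ and on its current neighbours; (4) remove the auxiliary vertices. Then there is a graph $\mathcal G_c$ on the output vertices such that $\mathcal Q_c=(\mathcal G_c,\mathcal C_c)$, and $\mathcal G_c$ is obtained from the encoding graph without input vertices by Procedure 1; all the steps are defined, and the final graph does not depend on the order in step (3). If moreover $\mathcal C_{\rm out}$ is linear, with a given basis, then $\mathcal Q_c=(\mathcal G_c,\mathcal C_c)$ is a graph code, with the basis of $\mathcal C_c$ obtained by concatenating the basis words of $\mathcal C_{\rm out}$; its encoder is the encoder of $\mathcal Q_{\rm out}$ followed by the encoder of $\mathcal Q_{\rm in}$ on each block; and $\mathcal G_c^{\mathcal C_c}$ is obtained from the encoding graph with input vertices by Procedure 1, again for every order in step (3). -/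

import Mathlib

open Matrix
open scoped Kronecker

/-! Graphs with edges labelled by `ZMod p`, qupit states, graph states and CWS codes. -/

/-- A graph on the vertex set `V` whose edges are labelled by nonzero elements of `ZMod p`, given by
its adjacency matrix (label `0` means that there is no edge). -/
@[ext]
structure LabeledGraph (p : ℕ) (V : Type*) where
  /-- the adjacency matrix -/
  adj : Matrix V V (ZMod p)
  symm : ∀ i j, adj i j = adj j i
  loopless : ∀ i, adj i i = 0

/-- A CWS code on qupits indexed by `V`: a labelled graph and a classical code, linear or not. -/
structure CWSCode (p : ℕ) (V : Type*) where
  /-- the graph -/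
  graph : LabeledGraph p V
  /-- the classical code, a set of vectors indexed by the vertices -/
  code : Set (V → ZMod p)

/-- A graph code: a labelled graph and a linear classical code, given by a basis of it (the rows of
a generator matrix). The index type `I` labels the encoded qupits. -/
structure GraphCode (p : ℕ) (V I : Type*) where
  /-- the graph -/
  graph : LabeledGraph p V
  /-- the generator matrix -/
  gen : Matrix I V (ZMod p)
  linInd : LinearIndependent (ZMod p) gen.row

/-- The CWS code underlying a graph code: its classical code consists of all the linear
combinations of the rows of the generator matrix. -/
def GraphCode.toCWS {p : ℕ} {V I : Type*} (Q : GraphCode p V I) : CWSCode p V where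
  graph := Q.graph
  code := (Submodule.span (ZMod p) (Set.range Q.gen.row) : Set (V → ZMod p))

section Graphs

variable {p : ℕ}

/-- The induced subgraph on the left part of the vertex set, i.e. all the vertices of the right
part are removed. -/
def LabeledGraph.removeRight {R A : Type*} (F : LabeledGraph p (R ⊕ A)) : LabeledGraph p R where
  adj := F.adj.toBlocks₁₁
  symm := fun i j => F.symm (Sum.inl i) (Sum.inl j)
  loopless := fun i => F.loopless (Sum.inl i)

/-- The graphical representation of a graph code: one input vertex for every encoded qupit is added
to the graph, and joined to the vertices by edges labelled by the generator matrix. -/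
def GraphCode.toGraph {V I : Type*} (Q : GraphCode p V I) : LabeledGraph p (I ⊕ V) where
  adj := Matrix.fromBlocks 0 Q.gen Q.genᵀ Q.graph.adj
  symm := by
    rintro (i | i) (j | j)
    · simp
    · simp
    · simp
    · simp [Q.graph.symm i]
  loopless := by
    rintro (i | i) <;> simp [Q.graph.loopless]

/-- Generalized local complementation at `(i, v)`, for a vector `v` that vanishes at `i` and at all
its neighbours. -/
def LabeledGraph.glc {V : Type*} (F : LabeledGraph p V) (i : V) (v : V → ZMod p)
    (hv : ∀ j, (j = i ∨ F.adj i j ≠ 0) → v j = 0) : LabeledGraph p V where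
  adj := F.adj + Matrix.vecMulVec v (F.adj i) + Matrix.vecMulVec (F.adj i) v
  symm := by
    intro a b
    simp only [Matrix.add_apply, Matrix.vecMulVec_apply, F.symm a b]
    ring
  loopless := by
    intro a
    by_cases h : F.adj i a = 0
    · simp [Matrix.vecMulVec_apply, F.loopless, h]
    · simp [Matrix.vecMulVec_apply, F.loopless, hv a (Or.inr h)]

/-- `GLCSeq v l F F'`: starting from `F`, the generalized local complementations at `(i, v i)`, for
`i` running through the list `l`, can be performed one after the other (each is admissible on the
graph produced by the previous ones), and the result is `F'`. -/
inductive GLCSeq {V A : Type*} (v : A → V → ZMod p) (e : A → V) :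
    List A → LabeledGraph p V → LabeledGraph p V → Prop
  | nil (F : LabeledGraph p V) : GLCSeq v e [] F F
  | cons (i : A) (l : List A) (F F' : LabeledGraph p V)
      (hv : ∀ j, (j = e i ∨ F.adj (e i) j ≠ 0) → v i j = 0)
      (h : GLCSeq v e l (F.glc (e i) (v i) hv) F') : GLCSeq v e (i :: l) F F'

/-- The labels of the edges from the auxiliary vertex `i` to output vertices, as a vector indexed by
all the vertices; its support is the set of the output vertices adjacent to `i`. Auxiliary vertices
are those of the right part, output vertices are those of the left part with `isOut r = true`. -/
def outputLabels {R A : Type*} (isOut : R → Bool) (F : LabeledGraph p (R ⊕ A)) (i : A) :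
    R ⊕ A → ZMod p
  | Sum.inl r => if isOut r then F.adj (Sum.inr i) (Sum.inl r) else 0
  | Sum.inr _ => 0

/-- All the edges between auxiliary vertices and output vertices are deleted. -/
def deleteAuxOutput {R A : Type*} (isOut : R → Bool) (F : LabeledGraph p (R ⊕ A)) :
    LabeledGraph p (R ⊕ A) where
  adj := Matrix.of fun
    | Sum.inl r, Sum.inl s => F.adj (Sum.inl r) (Sum.inl s)
    | Sum.inl r, Sum.inr i => if isOut r then 0 else F.adj (Sum.inl r) (Sum.inr i)
    | Sum.inr i, Sum.inl r => if isOut r then 0 else F.adj (Sum.inr i) (Sum.inl r)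
    | Sum.inr i, Sum.inr j => F.adj (Sum.inr i) (Sum.inr j)
  symm := by
    rintro (i | i) (j | j)
    · exact F.symm _ _
    · simp [F.symm (Sum.inl i)]
    · simp [F.symm (Sum.inr i)]
    · exact F.symm _ _
  loopless := by
    rintro (i | i) <;> simp [F.loopless]

/-- `GraphConcatenation isOut F F'`: delete all the edges between auxiliary and output vertices
of `F`, perform, for each auxiliary vertex `i`, a generalized local complementation at `i` with
respect to the labels of its deleted edges, and remove the auxiliary vertices. In whatever order the
auxiliary vertices are treated, all the steps are admissible and the final graph is `F'`. -/
def GraphConcatenation {R A : Type*} (isOut : R → Bool) (F : LabeledGraph p (R ⊕ A))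
    (F' : LabeledGraph p R) : Prop :=
  ∀ order : List A, order.Nodup → (∀ i, i ∈ order) →
    ∃ D : LabeledGraph p (R ⊕ A),
      GLCSeq (outputLabels isOut F) Sum.inr order (deleteAuxOutput isOut F) D ∧
        D.removeRight = F'

/-! Below, `N` indexes the `n'` blocks, `K` the qupits encoded by one copy of the inner code, `J` the
qupits of one copy of the inner code, and `I` the qupits encoded by a linear outer code. The
auxiliary vertices are indexed by `N × K`, the output vertices by `N × J`. -/

/-- The encoding graph of a concatenated code with a general outer graph: the outer graph on the
auxiliary vertices, a copy of the inner graph for each block, and edges between the auxiliary and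
the output vertices of the same block, labelled by the generator matrix of the inner code. -/
def encodingGraph {N K J : Type*} [DecidableEq N] (Qin : GraphCode p J K)
    (Gout : LabeledGraph p (N × K)) : LabeledGraph p ((N × J) ⊕ (N × K)) where
  adj := Matrix.fromBlocks ((1 : Matrix N N (ZMod p)) ⊗ₖ Qin.graph.adj)
    ((1 : Matrix N N (ZMod p)) ⊗ₖ Qin.gen)ᵀ ((1 : Matrix N N (ZMod p)) ⊗ₖ Qin.gen) Gout.adj
  symm := by
    rintro (i | i) (j | j)
    · simp [Matrix.kroneckerMap_apply, Matrix.one_apply, Qin.graph.symm i.2, eq_comm]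
    · simp [Matrix.kroneckerMap_apply]
    · simp [Matrix.kroneckerMap_apply]
    · simp [Gout.symm i]
  loopless := by
    rintro (i | i) <;>
      simp [Matrix.kroneckerMap_apply, Qin.graph.loopless, Gout.loopless]

/-- The encoding graph of a concatenated code with a linear outer code: the graphical representation
of the outer code on the input and auxiliary vertices, together with the copies of the inner graph
and the edges between auxiliary and output vertices as before. -/
def encodingGraphLinear {N K J I : Type*} [DecidableEq N] (Qin : GraphCode p J K)
    (Qout : GraphCode p (N × K) I) : LabeledGraph p ((I ⊕ (N × J)) ⊕ (N × K)) where
  adj := Matrix.of fun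
    | Sum.inl (Sum.inl r), Sum.inl (Sum.inl s) => Qout.toGraph.adj (Sum.inl r) (Sum.inl s)
    | Sum.inl (Sum.inl r), Sum.inr u => Qout.toGraph.adj (Sum.inl r) (Sum.inr u)
    | Sum.inr u, Sum.inl (Sum.inl r) => Qout.toGraph.adj (Sum.inr u) (Sum.inl r)
    | Sum.inl (Sum.inl _), Sum.inl (Sum.inr _) => 0
    | Sum.inl (Sum.inr _), Sum.inl (Sum.inl _) => 0
    | Sum.inl (Sum.inr x), Sum.inl (Sum.inr y) =>
        (encodingGraph Qin Qout.graph).adj (Sum.inl x) (Sum.inl y)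
    | Sum.inl (Sum.inr x), Sum.inr u => (encodingGraph Qin Qout.graph).adj (Sum.inl x) (Sum.inr u)
    | Sum.inr u, Sum.inl (Sum.inr x) => (encodingGraph Qin Qout.graph).adj (Sum.inr u) (Sum.inl x)
    | Sum.inr u, Sum.inr v => (encodingGraph Qin Qout.graph).adj (Sum.inr u) (Sum.inr v)
  symm := by
    rintro ((i | i) | i) ((j | j) | j) <;> simp only [Matrix.of_apply] <;>
      exact LabeledGraph.symm _ _ _
  loopless := by
    rintro ((i | i) | i) <;> simp only [Matrix.of_apply] <;> exact LabeledGraph.loopless _ _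

/-- Classical concatenation of a word: every block of the outer word is encoded by the generator
matrix of the inner code. -/
def concatWord {N K J : Type*} [Fintype K] (gen : Matrix K J (ZMod p)) (c : N × K → ZMod p) :
    N × J → ZMod p :=
  fun x => ((fun a => c (x.1, a)) ᵥ* gen) x.2

/-- The classical concatenated code. -/
def concatCode {N K J : Type*} [Fintype K] (gen : Matrix K J (ZMod p))
    (C : Set (N × K → ZMod p)) : Set (N × J → ZMod p) :=
  concatWord gen '' C

/-- Two auxiliary vertices of the same block that are joined in the outer graph have no common
output neighbour. This is automatic if `K` has one element, and if the outer graph has no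
edge inside a block. -/
def BlockAdmissible {N K J : Type*} (Qin : GraphCode p J K) (Gout : LabeledGraph p (N × K)) : Prop :=
  ∀ (i : N) (a b : K), a ≠ b → Gout.adj (i, a) (i, b) ≠ 0 →
    ∀ j : J, Qin.gen a j = 0 ∨ Qin.gen b j = 0

end Graphs

noncomputable section Quantum

variable {p : ℕ} [Fact p.Prime]

/-- The vector space of the pure states of qupits indexed by `V`, in the coordinates given by the
standard basis `|x⟩`, `x : V → ZMod p`. -/
abbrev QState (p : ℕ) (V : Type*) := (V → ZMod p) → ℂ

/-- The Hadamard gate, with matrix entries `ω ^ (r * s) / √p`, where `ω = exp (2 * π * i / p)`; it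
maps `|r̂⟩ = (1 / √p) ∑ s, ω ^ (- r * s) |s⟩` to `|r⟩`. -/
def hadamard (p : ℕ) [Fact p.Prime] : Matrix (ZMod p) (ZMod p) ℂ :=
  Matrix.of fun r s => ZMod.stdAddChar (r * s) / (Real.sqrt p : ℂ)

/-- A one-qupit gate applied to each of the qupits indexed by `V`. -/
def tensorGate {V : Type*} [Fintype V] (U : Matrix (ZMod p) (ZMod p) ℂ) :
    Matrix (V → ZMod p) (V → ZMod p) ℂ :=
  Matrix.of fun x y => ∏ i, U (x i) (y i)

/-- The Pauli operator `Z ^ c`. -/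
def pauliZ {V : Type*} [Fintype V] [DecidableEq V] (c : V → ZMod p) :
    Matrix (V → ZMod p) (V → ZMod p) ℂ :=
  Matrix.diagonal fun x => ZMod.stdAddChar (c ⬝ᵥ x)

/-- The exponent of `ω` contributed by the controlled-`Z` gate on an edge of a labelled graph. -/
def edgeExponent {V : Type*} (G : LabeledGraph p V) (x : V → ZMod p) : Sym2 V → ZMod p :=
  Sym2.lift ⟨fun i j => G.adj i j * (x i * x j), fun i j => by
    simp only [G.symm i j, mul_comm (x i)]⟩

/-- The gates `C_z ^ (g i j)`, applied once to every unordered pair of vertices of a graph. -/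
def czGraph {V : Type*} [Fintype V] [DecidableEq V] (G : LabeledGraph p V) :
    Matrix (V → ZMod p) (V → ZMod p) ℂ :=
  Matrix.diagonal fun x => ∏ e : Sym2 V, ZMod.stdAddChar (edgeExponent G x e)

/-- The graph state: start with `|0 … 0⟩`, apply the inverse Hadamard gate to every qupit, and then
the controlled-`Z` gates of the graph. -/
def graphState {V : Type*} [Fintype V] [DecidableEq V] (G : LabeledGraph p V) : QState p V :=
  czGraph G *ᵥ (tensorGate (hadamard p)ᴴ *ᵥ Pi.single 0 1)

/-- The quantum code (a subspace) of a CWS code: the span of the states `Z ^ c |ψ⟩`, where `|ψ⟩` is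
the graph state and `c` runs through the classical code. -/
def CWSCode.space {V : Type*} [Fintype V] [DecidableEq V] (Q : CWSCode p V) :
    Submodule ℂ (QState p V) :=
  Submodule.span ℂ ((fun c => pauliZ c *ᵥ graphState Q.graph) '' Q.code)

/-- The encoding circuit of a graph code, as a linear map from the states of the encoded qupits to
the states of the qupits of the code. From right to left: adjoin the graph state to the state to be
encoded; apply the inverse Hadamard gate to all the input qupits; apply `C_z` to the power
`gen i j` to input qupit `i` and qupit `j` of the graph state; apply the Hadamard gate to all the
input qupits; measure the input qupits in the computational basis, with outcome `0`, and normalize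
(the outcome has probability `p ^ (- |I|)`). -/
def GraphCode.encoder {V I : Type*} [Fintype V] [DecidableEq V] [Fintype I] [DecidableEq I]
    (Q : GraphCode p V I) : Matrix (V → ZMod p) (I → ZMod p) ℂ :=
  let append : Matrix ((I → ZMod p) × (V → ZMod p)) (I → ZMod p) ℂ :=
    Matrix.of fun z x => if z.1 = x then graphState Q.graph z.2 else 0
  let hadamardInv : Matrix ((I → ZMod p) × (V → ZMod p)) ((I → ZMod p) × (V → ZMod p)) ℂ :=
    tensorGate (hadamard p)ᴴ ⊗ₖ 1
  let cz : Matrix ((I → ZMod p) × (V → ZMod p)) ((I → ZMod p) × (V → ZMod p)) ℂ :=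
    Matrix.diagonal fun z => ∏ i, ∏ j, ZMod.stdAddChar (Q.gen i j * (z.1 i * z.2 j))
  let hadamards : Matrix ((I → ZMod p) × (V → ZMod p)) ((I → ZMod p) × (V → ZMod p)) ℂ :=
    tensorGate (hadamard p) ⊗ₖ 1
  let outcomeZero : Matrix (V → ZMod p) ((I → ZMod p) × (V → ZMod p)) ℂ :=
    Matrix.of fun y z => if z = (0, y) then 1 else 0
  (Real.sqrt p : ℂ) ^ Fintype.card I • (outcomeZero * hadamards * cz * hadamardInv * append)

/-- The tensor power of a linear map: it is applied separately to each of the blocks indexed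
by `N`. -/
def blockwise {N K J : Type*} [Fintype N] (E : Matrix (J → ZMod p) (K → ZMod p) ℂ) :
    Matrix (N × J → ZMod p) (N × K → ZMod p) ℂ :=
  Matrix.of fun y x => ∏ i, E (fun j => y (i, j)) (fun a => x (i, a))

/-- The concatenated quantum code: the image of the outer code under the blockwise encoding by the
inner code. -/
def concatSpace {N K J : Type*} [Fintype N] [DecidableEq N] [Fintype K] [DecidableEq K]
    [Fintype J] [DecidableEq J] (Qin : GraphCode p J K) (Qout : CWSCode p (N × K)) :
    Submodule ℂ (QState p (N × J)) :=
  Submodule.map (blockwise (N := N) Qin.encoder).mulVecLin Qout.space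

end Quantum

/-! In the standard basis a graph state is a quadratic phase: its amplitude at `x` is `ω ^ q(x) / √p
^ |V|`, with `q` the quadratic form of the graph. The encoder of a graph code has at most one
nonzero entry in each row, since the sum over the input register forces `x = gen *ᵥ y`
(`GraphCode.encoder_apply`). Hence, with `B = 1 ⊗ gen`, blockwise encoding pulls a state back along
`y ↦ B y` and multiplies it by the inner graph states (`blockwise_encoder_mulVec`). Under this
pullback `Z ^ c` becomes `Z ^ (c B)`, and the phases add up to `∑ q_in(y_i) + q_out(B y)`. This sum
is again the form of a loopless graph, with matrix `1 ⊗ A_in + Bᵀ A_out B` (`quadForm_concatGraph`).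
Block admissibility enters here: a column of `B` is supported on pairwise nonadjacent auxiliary
vertices, so `q_out` vanishes on it and no one-qupit phase appears. On the graph side, the
successive local complementations compose to a congruence by `1 + ∑ v_u e_uᵀ`
(`GLCSeq.exists_of_disjoint`). It does not depend on the order, and its output block is the same
matrix. -/

namespace LabeledGraph

/-! ### Quadratic forms of labelled graphs -/

section QuadraticForm

variable {p : ℕ} [Fact p.Prime] {V : Type*} [Fintype V]

/-- The quadratic form `∑ g i j * x i * x j` of a labelled graph, the sum being over the unordered
pairs of vertices. -/
def quadForm (G : LabeledGraph p V) (x : V → ZMod p) : ZMod p :=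
  ∑ e : Sym2 V, edgeExponent G x e

theorem quadForm_eq_zero (G : LabeledGraph p V) (x : V → ZMod p)
    (h : ∀ i j, G.adj i j ≠ 0 → x i = 0 ∨ x j = 0) : G.quadForm x = 0 := by
  refine Finset.sum_eq_zero fun e _ => ?_
  induction e with
  | h i j =>
    simp only [edgeExponent, Sym2.lift_mk]
    by_cases hij : G.adj i j = 0
    · simp [hij]
    · rcases h i j hij with h | h <;> simp [h]

variable [DecidableEq V]

/-- The fibre of `V × V → Sym2 V` over `s(i, j)` is `{(i, j), (j, i)}`; over the diagonal it is a
single point, where `hf` makes both sides zero. No division by 2 occurs, so `p = 2` is covered. -/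
theorem sum_sym2_symmetrize {M : Type*} [AddCommMonoid M] (f : V → V → M) (hf : ∀ i, f i i = 0)
    (g : Sym2 V → M) (hg : ∀ i j, g s(i, j) = f i j + f j i) :
    ∑ e : Sym2 V, g e = ∑ i, ∑ j, f i j := by
  rw [← Fintype.sum_prod_type' (f := f),
    ← Finset.sum_fiberwise_of_maps_to (s := Finset.univ) (t := (Finset.univ : Finset (Sym2 V)))
      (g := fun z : V × V => s(z.1, z.2)) (fun _ _ => Finset.mem_univ _)]
  refine Finset.sum_congr rfl fun e _ => ?_
  induction e with
  | h i j =>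
    rw [hg]
    have hset : (Finset.univ.filter fun z : V × V => s(z.1, z.2) = s(i, j)) =
        {(i, j), (j, i)} := by
      ext ⟨a, b⟩
      simp
    rw [hset]
    by_cases hij : i = j
    · subst hij
      simp [hf]
    · rw [Finset.sum_pair (by simp [hij])]

theorem quadForm_add (G : LabeledGraph p V) (x y : V → ZMod p) :
    G.quadForm (x + y) = G.quadForm x + G.quadForm y + x ⬝ᵥ (G.adj *ᵥ y) := by
  have h : x ⬝ᵥ (G.adj *ᵥ y) = ∑ i, ∑ j, G.adj i j * (x i * y j) := by
    simp only [dotProduct, mulVec, Finset.mul_sum]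
    exact Finset.sum_congr rfl fun i _ => Finset.sum_congr rfl fun j _ => by ring
  rw [h, ← sum_sym2_symmetrize (fun i j => G.adj i j * (x i * y j)) (by simp [G.loopless])
    (fun e => edgeExponent G (x + y) e - edgeExponent G x e - edgeExponent G y e)]
  · simp only [quadForm, Finset.sum_sub_distrib]
    ring
  · intro i j
    simp only [edgeExponent, Sym2.lift_mk, Pi.add_apply, G.symm j i]
    ring

theorem quadForm_single (G : LabeledGraph p V) (i : V) (t : ZMod p) :
    G.quadForm (Pi.single i t) = 0 := by
  refine G.quadForm_eq_zero _ fun a b hab => ?_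
  by_cases ha : a = i
  · by_cases hb : b = i
    · subst ha hb
      exact absurd (G.loopless _) hab
    · simp [hb]
  · simp [ha]

/-- A quadratic form is determined by its polar form and its values on the multiples of the
standard basis vectors. -/
theorem eq_quadForm (G : LabeledGraph p V) (q : (V → ZMod p) → ZMod p)
    (hadd : ∀ x y, q (x + y) = q x + q y + x ⬝ᵥ (G.adj *ᵥ y))
    (hsingle : ∀ i t, q (Pi.single i t) = 0) (x : V → ZMod p) : q x = G.quadForm x := by
  -- Two functions with the same polar form differ by an additive map, which is determined by its
  -- values on the `Pi.single i t`.
  let d : (V → ZMod p) →+ ZMod p := AddMonoidHom.mk' (fun x => q x - G.quadForm x) fun x y => by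
    rw [hadd, quadForm_add]
    ring
  have hd : d = 0 := by
    refine AddMonoidHom.functions_ext _ _ _ fun i t => ?_
    simp [d, hsingle, quadForm_single]
  exact sub_eq_zero.mp (DFunLike.congr_fun hd x)

end QuadraticForm

end LabeledGraph

/-! ### Amplitudes of graph states and of encoders -/

section States

variable {p : ℕ} [Fact p.Prime] {V I : Type*} [Fintype V] [Fintype I]

theorem stdAddChar_sum {ι : Type*} (s : Finset ι) (f : ι → ZMod p) :
    (ZMod.stdAddChar (∑ i ∈ s, f i) : ℂ) = ∏ i ∈ s, (ZMod.stdAddChar (f i) : ℂ) :=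
  map_prod (ZMod.stdAddChar (N := p)).toMonoidHom (fun i => Multiplicative.ofAdd (f i)) s

theorem tensorGate_hadamard_zero (r : I → ZMod p) :
    tensorGate (hadamard p) 0 r = 1 / (Real.sqrt p : ℂ) ^ Fintype.card I := by
  simp [tensorGate, _root_.hadamard, Finset.card_univ]

theorem tensorGate_hadamard_conjTranspose (r s : I → ZMod p) :
    tensorGate (hadamard p)ᴴ r s =
      ZMod.stdAddChar (-(r ⬝ᵥ s)) / (Real.sqrt p : ℂ) ^ Fintype.card I := by
  simp only [tensorGate, _root_.hadamard, of_apply, conjTranspose_apply, dotProduct,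
    ← Finset.sum_neg_distrib, stdAddChar_sum, star_div₀, Finset.prod_div_distrib,
    Finset.prod_const, Finset.card_univ]
  congr 1
  · refine Finset.prod_congr rfl fun i _ => ?_
    rw [AddChar.map_neg_eq_conj, mul_comm]
    rfl
  · simp

variable [DecidableEq V] [DecidableEq I]

theorem graphState_apply (G : LabeledGraph p V) (x : V → ZMod p) :
    graphState G x = ZMod.stdAddChar (G.quadForm x) / (Real.sqrt p : ℂ) ^ Fintype.card V := by
  have h : (tensorGate (hadamard p)ᴴ *ᵥ Pi.single 0 1 : QState p V) x =
      1 / (Real.sqrt p : ℂ) ^ Fintype.card V := by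
    simp [mulVec_single, tensorGate, _root_.hadamard, conjTranspose_apply, Finset.card_univ]
  rw [graphState, czGraph, mulVec_diagonal, h, LabeledGraph.quadForm, stdAddChar_sum]
  ring

theorem sum_stdAddChar_dotProduct (u : I → ZMod p) :
    ∑ r : I → ZMod p, (ZMod.stdAddChar (r ⬝ᵥ u) : ℂ) =
      if u = 0 then (p : ℂ) ^ Fintype.card I else 0 := by
  have h (r : I → ZMod p) :
      (ZMod.stdAddChar (r ⬝ᵥ u) : ℂ) = ∏ i, ZMod.stdAddChar (r i * u i) := by
    rw [dotProduct, stdAddChar_sum]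
  simp only [h]
  rw [← Fintype.prod_sum (fun i (t : ZMod p) => (ZMod.stdAddChar (t * u i) : ℂ))]
  have h1 (s : ZMod p) :
      ∑ t : ZMod p, (ZMod.stdAddChar (t * s) : ℂ) = if s = 0 then (p : ℂ) else 0 := by
    rw [AddChar.sum_mulShift s (ZMod.isPrimitive_stdAddChar p)]
    simp [ZMod.card]
  simp only [h1]
  split_ifs with hu
  · simp [hu, Finset.card_univ]
  · obtain ⟨i, hi⟩ := Function.ne_iff.mp hu
    exact Finset.prod_eq_zero (Finset.mem_univ i) (if_neg hi)

/-- Between the two Hadamard layers the input register takes a value `r`, and its phases combine to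
`ω ^ (r ⬝ᵥ (gen *ᵥ y - x))`. Orthogonality of characters turns the sum over `r` into the condition
`gen *ᵥ y = x`. The factor `p ^ |I|` of that sum cancels the two Hadamard normalizations, so the
normalization of the measurement remains. -/
theorem GraphCode.encoder_apply (Q : GraphCode p V I) (y : V → ZMod p) (x : I → ZMod p) :
    Q.encoder y x = if Q.gen *ᵥ y = x then
      (Real.sqrt p : ℂ) ^ Fintype.card I * graphState Q.graph y else 0 := by
  have hp : (Real.sqrt p : ℂ) * (Real.sqrt p : ℂ) = p := by
    rw [← Complex.ofReal_mul, Real.mul_self_sqrt (Nat.cast_nonneg p)]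
    simp
  have hs : (Real.sqrt p : ℂ) ≠ 0 := by
    intro h
    rw [h, zero_mul] at hp
    exact (Fact.out : p.Prime).ne_zero (by exact_mod_cast hp.symm)
  have hc (r : I → ZMod p) : (∏ i, ∏ j, (ZMod.stdAddChar (Q.gen i j * (r i * y j)) : ℂ)) =
      ZMod.stdAddChar (r ⬝ᵥ (Q.gen *ᵥ y)) := by
    simp only [dotProduct, mulVec, stdAddChar_sum, Finset.mul_sum]
    exact Finset.prod_congr rfl fun i _ => Finset.prod_congr rfl fun j _ => by
      congr 1
      ring
  have key : Q.encoder y x = (Real.sqrt p : ℂ) ^ Fintype.card I * ∑ r : I → ZMod p,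
      1 / (Real.sqrt p : ℂ) ^ Fintype.card I * ZMod.stdAddChar (r ⬝ᵥ (Q.gen *ᵥ y)) *
        (ZMod.stdAddChar (-(r ⬝ᵥ x)) / (Real.sqrt p : ℂ) ^ Fintype.card I) *
          graphState Q.graph y := by
    simp only [GraphCode.encoder, Matrix.smul_apply, smul_eq_mul, Matrix.mul_apply, Fintype.sum_prod_type,
      kroneckerMap_apply, diagonal_apply, of_apply, one_apply, Prod.mk.injEq,
      ite_and, ite_mul, mul_ite, zero_mul, mul_zero, one_mul, mul_one,
      Finset.sum_ite_eq', Finset.mem_univ, if_true,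
      tensorGate_hadamard_zero, tensorGate_hadamard_conjTranspose]
    rw [Finset.sum_comm]
    simp only [Finset.sum_ite_eq', Finset.mem_univ, if_true]
    rw [Finset.sum_eq_single y (by simp +contextual) (by simp)]
    simp only [if_true, hc, Finset.sum_mul]
  have hsum : ∑ r : I → ZMod p, 1 / (Real.sqrt p : ℂ) ^ Fintype.card I *
      ZMod.stdAddChar (r ⬝ᵥ (Q.gen *ᵥ y)) *
        (ZMod.stdAddChar (-(r ⬝ᵥ x)) / (Real.sqrt p : ℂ) ^ Fintype.card I) *
          graphState Q.graph y =
      (∑ r : I → ZMod p, (ZMod.stdAddChar (r ⬝ᵥ (Q.gen *ᵥ y - x)) : ℂ)) *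
        (graphState Q.graph y / (p : ℂ) ^ Fintype.card I) := by
    rw [Finset.sum_mul]
    refine Finset.sum_congr rfl fun r _ => ?_
    rw [dotProduct_sub, sub_eq_add_neg, AddChar.map_add_eq_mul, ← hp, mul_pow]
    field_simp
  have hp0 : (p : ℂ) ≠ 0 := by
    rw [← hp]
    exact mul_ne_zero hs hs
  rw [key, hsum, sum_stdAddChar_dotProduct]
  simp only [sub_eq_zero]
  split_ifs
  · field_simp
  · simp

end States

/-! ### Sequences of generalized local complementations -/

section LocalComplementation

variable {p : ℕ}

/-- If the vectors `v u` vanish on the vertices `e w`, and if `v u` and `v w` have disjoint supports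
whenever `e u` and `e w` are adjacent, then generalized local complementations at the `(e u, v u)`
can be performed one after the other, and the result is the congruence transform of the adjacency
matrix by `1 + ∑ u, v u * e uᵀ`. -/
theorem GLCSeq.exists_of_disjoint {V A : Type*} [DecidableEq A] (v : A → V → ZMod p) (e : A → V)
    (hve : ∀ u w, v u (e w) = 0) (l : List A) (hl : l.Nodup) (F : LabeledGraph p V)
    (hadm : ∀ u ∈ l, ∀ b, v u b = 0 ∨ F.adj (e u) b = 0)
    (hdisj : ∀ u ∈ l, ∀ w ∈ l, F.adj (e u) (e w) ≠ 0 → ∀ b, v u b = 0 ∨ v w b = 0) :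
    ∃ D, GLCSeq v e l F D ∧ ∀ a b, D.adj a b = F.adj a b +
      ∑ u ∈ l.toFinset, v u a * F.adj (e u) b + ∑ u ∈ l.toFinset, F.adj a (e u) * v u b +
        ∑ u ∈ l.toFinset, ∑ w ∈ l.toFinset, v u a * F.adj (e u) (e w) * v w b := by
  induction l generalizing F with
  | nil => exact ⟨F, .nil F, by simp⟩
  | cons i l ih =>
    have hv : ∀ j, (j = e i ∨ F.adj (e i) j ≠ 0) → v i j = 0 := by
      rintro j (rfl | hj)
      · exact hve _ _
      · exact (hadm i (by simp) j).resolve_right hj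
    -- Since `v i` vanishes at `e u`, the row of `e u` changes only by a multiple of `v i`, and the
    -- entries between the vertices `e u` do not change at all.
    have hrow (u : A) (b : V) : (F.glc (e i) (v i) hv).adj (e u) b =
        F.adj (e u) b + F.adj (e i) (e u) * v i b := by
      simp [LabeledGraph.glc, vecMulVec_apply, hve]
    have hcol (a : V) (u : A) : (F.glc (e i) (v i) hv).adj a (e u) =
        F.adj a (e u) + v i a * F.adj (e i) (e u) := by
      simp [LabeledGraph.glc, vecMulVec_apply, hve]
    have haux (u w : A) : (F.glc (e i) (v i) hv).adj (e u) (e w) = F.adj (e u) (e w) := by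
      rw [hrow, hve, mul_zero, add_zero]
    obtain ⟨hil, hl⟩ := List.nodup_cons.mp hl
    obtain ⟨D, hD, hDadj⟩ := ih hl (F.glc (e i) (v i) hv)
      (fun u hu b => by
        rw [hrow]
        by_cases hub : v u b = 0
        · exact Or.inl hub
        · refine Or.inr ?_
          rw [(hadm u (by simp [hu]) b).resolve_left hub, zero_add]
          -- The row of `e u` is altered only if `e i` and `e u` are adjacent, and then `v i`
          -- vanishes on the support of `v u`: admissibility survives.
          by_cases hiu : F.adj (e i) (e u) = 0
          · rw [hiu, zero_mul]
          · rw [(hdisj i (by simp) u (by simp [hu]) hiu b).resolve_right hub, mul_zero])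
      (fun u hu w hw huw => by
        rw [haux] at huw
        exact hdisj u (by simp [hu]) w (by simp [hw]) huw)
    refine ⟨D, .cons i l F D hv hD, fun a b => ?_⟩
    have hil' : i ∉ l.toFinset := by simpa using hil
    rw [hDadj]
    -- The changes of the rows and columns of the `e u` supply the cross terms between `i` and `l`
    -- of the double sum; its `(i, i)` term vanishes because there are no loops.
    simp only [haux, hrow, hcol, List.toFinset_cons, Finset.sum_insert hil', mul_add, add_mul,
      Finset.sum_add_distrib, F.loopless]
    have hab : (F.glc (e i) (v i) hv).adj a b =
        F.adj a b + v i a * F.adj (e i) b + F.adj a (e i) * v i b := by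
      simp [LabeledGraph.glc, vecMulVec_apply, F.symm a (e i)]
    have hsymm : ∑ u ∈ l.toFinset, v u a * (F.adj (e i) (e u) * v i b) =
        ∑ u ∈ l.toFinset, v u a * F.adj (e u) (e i) * v i b :=
      Finset.sum_congr rfl fun u _ => by rw [F.symm (e i), mul_assoc]
    rw [hab, hsymm]
    ring

/-- After the deletion every auxiliary vertex is cut off from the support of its own vector, so the
sequence can start. The resulting matrix involves the list only through its set of elements, whence
independence of the order. -/
theorem graphConcatenation_of_disjoint {R A : Type*} [Fintype A] [DecidableEq A]
    (isOut : R → Bool) (F : LabeledGraph p (R ⊕ A)) (F' : LabeledGraph p R)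
    (hdisj : ∀ u w, F.adj (Sum.inr u) (Sum.inr w) ≠ 0 → ∀ r, isOut r = true →
      F.adj (Sum.inr u) (Sum.inl r) = 0 ∨ F.adj (Sum.inr w) (Sum.inl r) = 0)
    (hF' : ∀ r s, F'.adj r s = F.adj (Sum.inl r) (Sum.inl s) +
      ∑ u, outputLabels isOut F u (Sum.inl r) *
        (deleteAuxOutput isOut F).adj (Sum.inr u) (Sum.inl s) +
      ∑ u, (deleteAuxOutput isOut F).adj (Sum.inl r) (Sum.inr u) *
        outputLabels isOut F u (Sum.inl s) +
      ∑ u, ∑ w, outputLabels isOut F u (Sum.inl r) * F.adj (Sum.inr u) (Sum.inr w) *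
        outputLabels isOut F w (Sum.inl s)) :
    GraphConcatenation isOut F F' := by
  intro order hnodup hall
  obtain ⟨D, hD, hDadj⟩ := GLCSeq.exists_of_disjoint (outputLabels isOut F) Sum.inr
    (fun _ _ => rfl) order hnodup (deleteAuxOutput isOut F)
    (by
      rintro u - (r | w)
      · cases h : isOut r <;> simp [outputLabels, deleteAuxOutput, h]
      · exact Or.inl rfl)
    (by
      rintro u - w - huw (r | x)
      · cases h : isOut r
        · simp [outputLabels, h]
        · simpa [outputLabels, h] using hdisj u w huw r h
      · exact Or.inl rfl)
  have huniv : order.toFinset = Finset.univ := by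
    ext i
    simp [hall i]
  refine ⟨D, hD, LabeledGraph.ext ?_⟩
  ext r s
  rw [hF']
  change D.adj (Sum.inl r) (Sum.inl s) = _
  rw [hDadj, huniv]
  rfl

end LocalComplementation

/-! ### The concatenated graph and classical code -/

section Concatenation

variable {p : ℕ} {N K J I : Type*}

/-- The labels of the edges between the auxiliary and the output vertices. -/
def blockGen (N : Type*) [DecidableEq N] (gen : Matrix K J (ZMod p)) : Matrix (N × K) (N × J) (ZMod p) :=
  (1 : Matrix N N (ZMod p)) ⊗ₖ gen

theorem blockGen_mulVec [Fintype N] [DecidableEq N] [Fintype J] (gen : Matrix K J (ZMod p))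
    (y : N × J → ZMod p) (u : N × K) :
    (blockGen N gen *ᵥ y) u = (gen *ᵥ fun j => y (u.1, j)) u.2 := by
  simp [blockGen, mulVec, dotProduct, Fintype.sum_prod_type, kroneckerMap_apply, one_apply]

theorem concatWord_eq_vecMul [Fintype N] [DecidableEq N] [Fintype K] (gen : Matrix K J (ZMod p))
    (c : N × K → ZMod p) : concatWord gen c = c ᵥ* blockGen N gen := by
  ext x
  simp [concatWord, blockGen, vecMul, dotProduct, Fintype.sum_prod_type, kroneckerMap_apply,
    one_apply]

theorem concatWord_injective [Fact p.Prime] [Fintype K] (gen : Matrix K J (ZMod p))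
    (h : LinearIndependent (ZMod p) gen.row) :
    Function.Injective (concatWord gen : (N × K → ZMod p) → N × J → ZMod p) := by
  intro c d hcd
  ext ⟨i, a⟩
  have h1 : (fun a => c (i, a)) ᵥ* gen = (fun a => d (i, a)) ᵥ* gen := by
    ext j
    exact congrFun hcd (i, j)
  exact congrFun (Matrix.vecMul_injective_iff.mpr h h1) a

/-- Two auxiliary vertices that are joined in the outer graph have no common output neighbour. -/
theorem BlockAdmissible.blockGen_eq_zero [DecidableEq N] {Qin : GraphCode p J K}
    {Gout : LabeledGraph p (N × K)} (h : BlockAdmissible Qin Gout) {u v : N × K}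
    (huv : Gout.adj u v ≠ 0) (x : N × J) :
    blockGen N Qin.gen u x = 0 ∨ blockGen N Qin.gen v x = 0 := by
  obtain ⟨i, a⟩ := u
  obtain ⟨i', b⟩ := v
  obtain ⟨i₀, j⟩ := x
  simp only [blockGen, kroneckerMap_apply, one_apply, ite_mul, one_mul, zero_mul]
  by_cases hi : i = i₀
  · by_cases hi' : i' = i₀
    · subst hi hi'
      have hab : a ≠ b := by
        rintro rfl
        exact huv (Gout.loopless _)
      simpa using h _ a b hab huv j
    · simp [hi']
  · simp [hi]

/-- The graph of the concatenated code: copies of the inner graph, together with the edges produced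
by the generalized local complementations. -/
def concatGraph [Fintype N] [DecidableEq N] [Fintype K] (Qin : GraphCode p J K)
    (Gout : LabeledGraph p (N × K)) (h : BlockAdmissible Qin Gout) : LabeledGraph p (N × J) where
  adj := (1 : Matrix N N (ZMod p)) ⊗ₖ Qin.graph.adj +
    (blockGen N Qin.gen)ᵀ * Gout.adj * blockGen N Qin.gen
  symm := by
    have h1 : Gout.adjᵀ = Gout.adj := by
      ext i j
      exact Gout.symm j i
    have h2 : Qin.graph.adjᵀ = Qin.graph.adj := by
      ext i j
      exact Qin.graph.symm j i
    have h3 : ((1 : Matrix N N (ZMod p)) ⊗ₖ Qin.graph.adj +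
        (blockGen N Qin.gen)ᵀ * Gout.adj * blockGen N Qin.gen)ᵀ =
        (1 : Matrix N N (ZMod p)) ⊗ₖ Qin.graph.adj +
        (blockGen N Qin.gen)ᵀ * Gout.adj * blockGen N Qin.gen := by
      rw [transpose_add, transpose_mul, transpose_mul, transpose_transpose, h1,
        ← kroneckerMap_transpose, transpose_one, h2, Matrix.mul_assoc]
    intro i j
    exact congrFun (congrFun h3.symm i) j
  loopless := by
    rintro ⟨i, j⟩
    rw [Matrix.add_apply, kroneckerMap_apply, Qin.graph.loopless, mul_zero, zero_add,
      Matrix.mul_apply]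
    simp only [Matrix.mul_apply, Finset.sum_mul]
    -- A term survives only for adjacent `u`, `v` with the common output neighbour `(i, j)`, which
    -- admissibility excludes.
    refine Finset.sum_eq_zero fun v _ => Finset.sum_eq_zero fun u _ => ?_
    by_cases huv : Gout.adj u v = 0
    · simp [huv]
    · rcases h.blockGen_eq_zero huv (i, j) with h | h <;> simp [h]

/-- All left vertices are outputs, so the deletion kills the terms linear in the label vectors; the
double sum is `Bᵀ A_out B`. -/
theorem graphConcatenation_encodingGraph [Fintype N] [DecidableEq N] [Fintype K] [DecidableEq K]
    (Qin : GraphCode p J K) (Gout : LabeledGraph p (N × K)) (h : BlockAdmissible Qin Gout) :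
    GraphConcatenation (fun _ => true) (encodingGraph Qin Gout) (concatGraph Qin Gout h) := by
  refine graphConcatenation_of_disjoint _ _ _ (fun u w huw r _ => h.blockGen_eq_zero huw r) ?_
  intro r s
  simp [encodingGraph, concatGraph, outputLabels, deleteAuxOutput, blockGen, Matrix.mul_apply,
    Finset.sum_mul]
  exact Finset.sum_comm

/-- The concatenation of two graph codes. -/
def concatGraphCode [Fact p.Prime] [Fintype N] [DecidableEq N] [Fintype K] (Qin : GraphCode p J K)
    (Qout : GraphCode p (N × K) I) (h : BlockAdmissible Qin Qout.graph) :
    GraphCode p (N × J) I where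
  graph := concatGraph Qin Qout.graph h
  gen := Qout.gen * blockGen N Qin.gen
  linInd := by
    have h1 := Qout.linInd.map' (blockGen N Qin.gen : Matrix _ (N × J) _).vecMulLinear
      (LinearMap.ker_eq_bot.mpr fun c d hcd => concatWord_injective Qin.gen Qin.linInd (by
        rw [concatWord_eq_vecMul, concatWord_eq_vecMul]
        exact hcd))
    exact h1

/-- Edges between input and auxiliary vertices are not deleted, so the linear terms now give
`Qout.gen * B` between inputs and outputs. The label vectors vanish on the inputs, so no edges
between inputs arise. -/
theorem graphConcatenation_encodingGraphLinear [Fact p.Prime] [Fintype N] [DecidableEq N]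
    [Fintype K] [DecidableEq K] (Qin : GraphCode p J K) (Qout : GraphCode p (N × K) I)
    (h : BlockAdmissible Qin Qout.graph) :
    GraphConcatenation Sum.isRight (encodingGraphLinear Qin Qout)
      (concatGraphCode Qin Qout h).toGraph := by
  refine graphConcatenation_of_disjoint _ _ _ ?_ ?_
  · rintro u w huw (r | r) hr
    · simp at hr
    · exact h.blockGen_eq_zero huw r
  · rintro (r | r) (s | s)
    · simp [encodingGraphLinear, GraphCode.toGraph, outputLabels]
    · simp [encodingGraphLinear, GraphCode.toGraph, outputLabels, deleteAuxOutput, concatGraphCode,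
        encodingGraph, blockGen, Matrix.mul_apply]
    · simp [encodingGraphLinear, GraphCode.toGraph, outputLabels, deleteAuxOutput, concatGraphCode,
        encodingGraph, blockGen, Matrix.mul_apply, mul_comm]
    · simp [encodingGraphLinear, GraphCode.toGraph, outputLabels, deleteAuxOutput, concatGraphCode,
        concatGraph, encodingGraph, blockGen, Matrix.mul_apply, Finset.sum_mul]
      exact Finset.sum_comm

theorem concatWord_concatGraphCode_gen [Fact p.Prime] [Fintype N] [DecidableEq N] [Fintype K]
    (Qin : GraphCode p J K) (Qout : GraphCode p (N × K) I) (h : BlockAdmissible Qin Qout.graph)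
    (i : I) : (concatGraphCode Qin Qout h).gen i = concatWord Qin.gen (Qout.gen i) := by
  rw [concatWord_eq_vecMul]
  rfl

theorem concatGraphCode_code [Fact p.Prime] [Fintype N] [DecidableEq N] [Fintype K]
    (Qin : GraphCode p J K) (Qout : GraphCode p (N × K) I) (h : BlockAdmissible Qin Qout.graph) :
    (concatGraphCode Qin Qout h).toCWS.code = concatCode Qin.gen Qout.toCWS.code := by
  have h1 : (concatWord Qin.gen : (N × K → ZMod p) → N × J → ZMod p) =
      (blockGen N Qin.gen : Matrix _ (N × J) _).vecMulLinear := by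
    ext1 c
    rw [concatWord_eq_vecMul]
    rfl
  rw [concatCode, h1]
  simp only [GraphCode.toCWS]
  rw [← Submodule.map_coe, Submodule.map_span, ← Set.range_comp]
  rfl

/-! ### The action of the blockwise encoder -/

section Encoding

variable [Fact p.Prime] [Fintype N] [DecidableEq N] [Fintype K] [DecidableEq K] [Fintype J]
  [DecidableEq J]

/-- Comparing polar forms would suffice for odd `p`; the check on multiples of basis vectors also
handles `p = 2`, and it is where admissibility is used. -/
theorem quadForm_concatGraph (Qin : GraphCode p J K) (Gout : LabeledGraph p (N × K))
    (h : BlockAdmissible Qin Gout) (y : N × J → ZMod p) :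
    ∑ i, Qin.graph.quadForm (fun j => y (i, j)) + Gout.quadForm (blockGen N Qin.gen *ᵥ y) =
      (concatGraph Qin Gout h).quadForm y := by
  refine LabeledGraph.eq_quadForm _ (fun y => ∑ i, Qin.graph.quadForm (fun j => y (i, j)) +
    Gout.quadForm (blockGen N Qin.gen *ᵥ y)) (fun x y => ?_) (fun z t => ?_) y
  · have hblock (i : N) : Qin.graph.quadForm (fun j => (x + y) (i, j)) =
        Qin.graph.quadForm (fun j => x (i, j)) + Qin.graph.quadForm (fun j => y (i, j)) +
          (fun j => x (i, j)) ⬝ᵥ (Qin.graph.adj *ᵥ fun j => y (i, j)) :=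
      Qin.graph.quadForm_add _ _
    have hin : ∑ i, (fun j => x (i, j)) ⬝ᵥ (Qin.graph.adj *ᵥ fun j => y (i, j)) =
        x ⬝ᵥ (((1 : Matrix N N (ZMod p)) ⊗ₖ Qin.graph.adj) *ᵥ y) := by
      change _ = x ⬝ᵥ (blockGen N Qin.graph.adj *ᵥ y)
      simp only [dotProduct, blockGen_mulVec, Fintype.sum_prod_type]
    have hout : (blockGen N Qin.gen *ᵥ x) ⬝ᵥ (Gout.adj *ᵥ (blockGen N Qin.gen *ᵥ y)) =
        x ⬝ᵥ (((blockGen N Qin.gen)ᵀ * Gout.adj * blockGen N Qin.gen) *ᵥ y) := by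
      rw [← mulVec_mulVec, ← mulVec_mulVec, dotProduct_mulVec x, vecMul_transpose]
    simp only [hblock, mulVec_add, Finset.sum_add_distrib, LabeledGraph.quadForm_add, hin, hout,
      concatGraph, add_mulVec, dotProduct_add]
    ring
  · have hin (i : N) : Qin.graph.quadForm
        (fun j => (Pi.single z t : N × J → ZMod p) (i, j)) = 0 := by
      refine LabeledGraph.quadForm_eq_zero _ _ fun a b hab => ?_
      simp only [Pi.single_apply]
      by_cases ha : (i, a) = z
      · by_cases hb : (i, b) = z
        · obtain rfl : a = b := congrArg Prod.snd (ha.trans hb.symm)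
          exact absurd (Qin.graph.loopless a) hab
        · exact Or.inr (if_neg hb)
      · exact Or.inl (if_neg ha)
    have hout : Gout.quadForm (blockGen N Qin.gen *ᵥ (Pi.single z t : N × J → ZMod p)) = 0 := by
      refine LabeledGraph.quadForm_eq_zero _ _ fun u v huv => ?_
      -- The vector is a multiple of column `z` of `B`, whose support contains no two adjacent
      -- auxiliary vertices.
      rw [mulVec_single]
      exact (h.blockGen_eq_zero huv z).imp (fun h => by simp [h]) (fun h => by simp [h])
    simp only [hin, hout, Finset.sum_const_zero, add_zero]

theorem prod_graphState_mul_graphState (Qin : GraphCode p J K) (Gout : LabeledGraph p (N × K))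
    (h : BlockAdmissible Qin Gout) (y : N × J → ZMod p) :
    (Real.sqrt p : ℂ) ^ Fintype.card (N × K) *
      (∏ i, graphState Qin.graph fun j => y (i, j)) *
        graphState Gout (blockGen N Qin.gen *ᵥ y) = graphState (concatGraph Qin Gout h) y := by
  have hs : (Real.sqrt p : ℂ) ≠ 0 := by
    rw [Complex.ofReal_ne_zero]
    exact (Real.sqrt_pos.mpr (Nat.cast_pos.mpr (Fact.out : p.Prime).pos)).ne'
  simp only [graphState_apply, ← quadForm_concatGraph, AddChar.map_add_eq_mul, stdAddChar_sum,
    Finset.prod_div_distrib, Finset.prod_const, Finset.card_univ, ← pow_mul, Fintype.card_prod,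
    mul_comm (Fintype.card J)]
  field_simp

theorem blockwise_encoder_apply (Qin : GraphCode p J K) (y : N × J → ZMod p)
    (x : N × K → ZMod p) :
    blockwise Qin.encoder y x = if blockGen N Qin.gen *ᵥ y = x then
      (Real.sqrt p : ℂ) ^ Fintype.card (N × K) *
        ∏ i, graphState Qin.graph fun j => y (i, j) else 0 := by
  simp only [blockwise, of_apply, GraphCode.encoder_apply]
  split_ifs with hx
  · subst hx
    simp only [blockGen_mulVec, if_true, Finset.prod_mul_distrib, Finset.prod_const,
      Finset.card_univ, ← pow_mul, Fintype.card_prod, mul_comm (Fintype.card K)]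
  · obtain ⟨u, hu⟩ := Function.ne_iff.mp hx
    refine Finset.prod_eq_zero (Finset.mem_univ u.1) (if_neg fun h => hu ?_)
    rw [blockGen_mulVec, h]

theorem blockwise_encoder_mulVec (Qin : GraphCode p J K) (φ : QState p (N × K))
    (y : N × J → ZMod p) : (blockwise Qin.encoder *ᵥ φ) y =
      (Real.sqrt p : ℂ) ^ Fintype.card (N × K) * (∏ i, graphState Qin.graph fun j => y (i, j)) *
        φ (blockGen N Qin.gen *ᵥ y) := by
  simp [mulVec, dotProduct, blockwise_encoder_apply]

/-- The phase of `Z ^ c` at `B y` is `c ⬝ᵥ (B y) = (c B) ⬝ᵥ y`, and `c B` is the concatenated word.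
-/
theorem blockwise_encoder_mulVec_pauliZ (Qin : GraphCode p J K) (Gout : LabeledGraph p (N × K))
    (h : BlockAdmissible Qin Gout) (c : N × K → ZMod p) :
    blockwise Qin.encoder *ᵥ (pauliZ c *ᵥ graphState Gout) =
      pauliZ (concatWord Qin.gen c) *ᵥ graphState (concatGraph Qin Gout h) := by
  ext y
  rw [blockwise_encoder_mulVec, pauliZ, pauliZ, mulVec_diagonal, mulVec_diagonal,
    ← prod_graphState_mul_graphState, concatWord_eq_vecMul, ← dotProduct_mulVec]
  ring

theorem concatSpace_eq (Qin : GraphCode p J K) (Qout : CWSCode p (N × K))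
    (h : BlockAdmissible Qin Qout.graph) :
    concatSpace Qin Qout =
      CWSCode.space ⟨concatGraph Qin Qout.graph h, concatCode Qin.gen Qout.code⟩ := by
  simp only [concatSpace, CWSCode.space, Submodule.map_span, concatCode, Set.image_image,
    mulVecLin_apply, blockwise_encoder_mulVec_pauliZ Qin Qout.graph h]

/-- Pulling a column of the outer encoder back along `B` turns its condition into `(Qout.gen * B) *ᵥ
y = z`, and its amplitude into that of the concatenated graph state. -/
theorem blockwise_encoder_mul_encoder [Fintype I] [DecidableEq I] (Qin : GraphCode p J K)
    (Qout : GraphCode p (N × K) I) (h : BlockAdmissible Qin Qout.graph) :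
    blockwise (N := N) Qin.encoder * Qout.encoder = (concatGraphCode Qin Qout h).encoder := by
  ext y z
  have h1 : (blockwise (N := N) Qin.encoder * Qout.encoder) y z =
      (blockwise Qin.encoder *ᵥ fun x => Qout.encoder x z) y := rfl
  rw [h1, blockwise_encoder_mulVec, GraphCode.encoder_apply, GraphCode.encoder_apply,
    mulVec_mulVec]
  simp only [concatGraphCode, ← prod_graphState_mul_graphState, mul_ite, mul_zero]
  congr 1
  ring

end Encoding

end Concatenation

theorem corollary1 {p : ℕ} [Fact p.Prime] {n k m : ℕ} (Qin : GraphCode p (Fin n) (Fin k)) :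
    (∀ Qout : CWSCode p (Fin m × Fin k), BlockAdmissible Qin Qout.graph →
      ∃ Qc : CWSCode p (Fin m × Fin n),
        concatSpace Qin Qout = Qc.space ∧
        Qc.code = concatCode Qin.gen Qout.code ∧
        GraphConcatenation (fun _ => true) (encodingGraph Qin Qout.graph) Qc.graph) ∧
    (∀ (l : ℕ) (Qout : GraphCode p (Fin m × Fin k) (Fin l)), BlockAdmissible Qin Qout.graph →
      ∃ Qc : GraphCode p (Fin m × Fin n) (Fin l),
        concatSpace Qin Qout.toCWS = Qc.toCWS.space ∧
        blockwise Qin.encoder * Qout.encoder = Qc.encoder ∧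
        (∀ i, Qc.gen i = concatWord Qin.gen (Qout.gen i)) ∧
        Qc.toCWS.code = concatCode Qin.gen Qout.toCWS.code ∧
        GraphConcatenation Sum.isRight (encodingGraphLinear Qin Qout) Qc.toGraph ∧
        GraphConcatenation (fun _ => true) (encodingGraph Qin Qout.graph) Qc.graph) := by
  refine ⟨fun Qout h => ⟨⟨concatGraph Qin Qout.graph h, concatCode Qin.gen Qout.code⟩,
    concatSpace_eq Qin Qout h, rfl, graphConcatenation_encodingGraph Qin Qout.graph h⟩,
    fun l Qout h => ⟨concatGraphCode Qin Qout h, ?_, blockwise_encoder_mul_encoder Qin Qout h,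
      concatWord_concatGraphCode_gen Qin Qout h, concatGraphCode_code Qin Qout h,
      graphConcatenation_encodingGraphLinear Qin Qout h,
      graphConcatenation_encodingGraph Qin Qout.graph h⟩⟩
  rw [concatSpace_eq Qin Qout.toCWS h, ← concatGraphCode_code Qin Qout h]
  rfl
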